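/- For an odd prime power $q$ let $G=SL_2(\mathbb{F}_q)$ and, for $g\in G$, let $$\mathcal{N}(g)=\frac{\#\{(x,y)\in G\times G:\ xyx^{-1}y^{-1}=g\}}{\#G}.$$ Then there is an absolute constant $C$ such that for every odd prime power $q$ and every $g\in SL_2(\mathbb{F}_q)$ with $g\neq\pm I$, $$|\mathcal{N}(g)-1|\le \frac{C}{q},$$ that is, $\mathcal{N}(g)=1+O(1/q)$ uniformly in $g\neq\pm I$. Explicitly, for all such $q$ and $g$, $$|\mathcal{N}(g)-1|\le \frac{6}{q+1}+\frac{13}{q^2-1}.$$ -/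

import Mathlib

open scoped MatrixGroups

/-- The fiber over `g` of the commutator map `(x, y) ↦ x * y * x⁻¹ * y⁻¹` of a group `G`. -/
def commutatorFiber {G : Type*} [Group G] (g : G) : Set (G × G) :=
  {p : G × G | p.1 * p.2 * p.1⁻¹ * p.2⁻¹ = g}

/-- The normalized cardinality `#{(x, y) ∈ G × G : [x, y] = g} / #G` of the fiber over `g`
of the commutator map, for a finite group `G`. -/
noncomputable def normalizedFiberCard {G : Type*} [Group G] [Finite G] (g : G) : ℝ :=
  (Nat.card (commutatorFiber g) : ℝ) / (Nat.card G : ℝ)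

/-!
With `z = x⁻¹`, the equation `x * y * x⁻¹ * y⁻¹ = g` says that `y` conjugates `z` to `z * g`. It
forces `tr (z * g) = tr z`, and once `g` is conjugated to a companion matrix, these `z` form a
surface whose number of points is `q ^ 2 + O(q)`. For noncentral `z` and `z * g` of equal trace,
the matrices intertwining them form a free module of rank one over `F[z]`, on which the determinant
is a multiple of the norm form of `F[z]`. A nonzero value is taken by this form `q ± 1` times when
`(tr z) ^ 2 ≠ 4` and at most `2 * q` times otherwise, which happens for only `O(q)` of the `z`.
Hence the fiber has `q ^ 3 + O(q ^ 2)` points, while `#SL(2, F) = q ^ 3 - q`.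
-/

section NormEquation

open Finset Polynomial

variable {F : Type*} [Field F]

theorem card_filter_quadratic_eq_zero_le_two [Fintype F] [DecidableEq F] {a b c : F}
    (h : a ≠ 0 ∨ b ≠ 0 ∨ c ≠ 0) : #{x : F | a * x ^ 2 + b * x + c = 0} ≤ 2 := by
  have hp : C a * X ^ 2 + C b * X + C c ≠ 0 := by
    intro hp
    have ha : a = 0 := by simpa [coeff_X, coeff_C] using congr_arg (coeff · 2) hp
    have hb : b = 0 := by simpa [coeff_X, coeff_C] using congr_arg (coeff · 1) hp
    have hc : c = 0 := by simpa using congr_arg (coeff · 0) hp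
    tauto
  refine (card_le_degree_of_subset_roots (p := C a * X ^ 2 + C b * X + C c) fun x hx ↦ ?_).trans
    natDegree_quadratic_le
  simpa [mem_roots hp] using hx

theorem card_filter_monic_quadratic_le {ι : Type*} [Fintype F] [DecidableEq F] [Fintype ι]
    (b c : ι → F) : #{p : F × ι | p.1 ^ 2 + b p.2 * p.1 + c p.2 = 0} ≤ 2 * Fintype.card ι := by
  have hsum : #{p : F × ι | p.1 ^ 2 + b p.2 * p.1 + c p.2 = 0} =
      ∑ i, #{x : F | 1 * x ^ 2 + b i * x + c i = 0} := by
    simp only [card_filter, Fintype.sum_prod_type_right, one_mul]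
  rw [hsum, mul_comm, ← smul_eq_mul, ← card_univ]
  exact sum_le_card_nsmul _ _ _ fun i _ ↦
    card_filter_quadratic_eq_zero_le_two (.inl one_ne_zero)

theorem card_norm_eq_of_split {r s δ : F} (hrs : r ≠ s) (hδ : δ ≠ 0) :
    Nat.card {k : QuadraticAlgebra F (-(r * s)) (r + s) // k.norm = δ} = Nat.card Fˣ := by
  have hd : r - s ≠ 0 := sub_ne_zero.2 hrs
  have norm_eq (k : QuadraticAlgebra F (-(r * s)) (r + s)) :
      k.norm = (k.re + r * k.im) * (k.re + s * k.im) := by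
    rw [QuadraticAlgebra.norm_def]
    ring
  have fst_ne_zero (k : {k : QuadraticAlgebra F (-(r * s)) (r + s) // k.norm = δ}) :
      k.1.re + r * k.1.im ≠ 0 := fun h ↦ hδ (by rw [← k.2, norm_eq, h, zero_mul])
  refine Nat.card_congr
    { toFun k := Units.mk0 (k.1.re + r * k.1.im) (fst_ne_zero k)
      invFun u := ⟨⟨u - r * ((u - δ / u) / (r - s)), (u - δ / u) / (r - s)⟩, ?_⟩
      left_inv k := ?_
      right_inv u := by ext; simp }
  · have hu := u.ne_zero
    rw [norm_eq]
    field_simp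
    ring
  · have hsnd : δ / (k.1.re + r * k.1.im) = k.1.re + s * k.1.im := by
      rw [div_eq_iff (fst_ne_zero k), mul_comm, ← norm_eq, k.2]
    have him : (r * k.1.im - s * k.1.im) / (r - s) = k.1.im := by
      rw [← sub_mul, mul_div_cancel_left₀ _ hd]
    ext <;> simp [hsnd, him]

theorem norm_surjective_of_irreducible [Finite F] {a b : F} (h : ∀ r, r ^ 2 ≠ a + b * r) :
    Function.Surjective
      (Units.map (QuadraticAlgebra.norm : QuadraticAlgebra F a b →* F)) := by
  have : Fact (∀ r, r ^ 2 ≠ a + b * r) := ⟨h⟩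
  have : Finite (QuadraticAlgebra F a b) := .of_equiv _ (QuadraticAlgebra.equivProd a b).symm
  have hnorm : (QuadraticAlgebra.norm : QuadraticAlgebra F a b →* F) = Algebra.norm F :=
    MonoidHom.ext fun k ↦ (QuadraticAlgebra.det_toLinearMap_eq_norm k).symm
  rw [hnorm]
  exact FiniteField.unitsMap_norm_surjective F _

theorem card_norm_eq_of_irreducible [Finite F] {a b δ : F} (h : ∀ r, r ^ 2 ≠ a + b * r)
    (hδ : δ ≠ 0) :
    Nat.card {k : QuadraticAlgebra F a b // k.norm = δ} = Nat.card F + 1 := by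
  have : Fact (∀ r, r ^ 2 ≠ a + b * r) := ⟨h⟩
  have hsurj := norm_surjective_of_irreducible h
  set f := Units.map (QuadraticAlgebra.norm : QuadraticAlgebra F a b →* F)
  have hfiber : Nat.card {k : QuadraticAlgebra F a b // k.norm = δ} = Nat.card f.ker :=
    Nat.card_congr <| .trans (β := f ⁻¹' {Units.mk0 δ hδ})
      { toFun k := ⟨Units.mk0 k.1 fun h0 ↦ hδ (by simp [← k.2, h0]), Units.ext k.2⟩
        invFun u := ⟨u.1.1, congr_arg Units.val u.2⟩
        left_inv _ := rfl
        right_inv _ := Subtype.ext (Units.ext rfl) }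
      (MonoidHom.fiberEquivKerOfSurjective hsurj _)
  have hcard := f.ker.card_mul_index
  rw [Subgroup.index_ker, MonoidHom.range_eq_top.2 hsurj, Subgroup.card_top, Nat.card_units,
    Nat.card_units, Nat.card_congr (QuadraticAlgebra.equivProd a b), Nat.card_prod,
    show 1 = 1 * 1 from rfl, Nat.mul_self_sub_mul_self_eq] at hcard
  rw [hfiber]
  exact Nat.eq_of_mul_eq_mul_right (Nat.sub_pos_of_lt Finite.one_lt_card) hcard

theorem abs_card_norm_eq_sub_le_one [Finite F] {a b δ : F} (hdisc : b ^ 2 + 4 * a ≠ 0)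
    (hδ : δ ≠ 0) :
    |(Nat.card {k : QuadraticAlgebra F a b // k.norm = δ} : ℤ) - Nat.card F| ≤ 1 := by
  by_cases! h : ∃ r, r ^ 2 = a + b * r
  · obtain ⟨r, hr⟩ := h
    obtain ⟨s, rfl⟩ : ∃ s, b = r + s := ⟨b - r, by ring⟩
    obtain rfl : a = -(r * s) := by linear_combination -hr
    have hrs : r ≠ s := by
      rintro rfl
      exact hdisc (by ring)
    rw [card_norm_eq_of_split hrs hδ, Nat.card_units, Nat.cast_sub Nat.card_pos]
    simp
  · simp [card_norm_eq_of_irreducible h hδ]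

theorem card_norm_eq_le_two_mul [Finite F] (a b δ : F) :
    Nat.card {k : QuadraticAlgebra F a b // k.norm = δ} ≤ 2 * Nat.card F := by
  classical
  have := Fintype.ofFinite F
  have hcard : Nat.card {k : QuadraticAlgebra F a b // k.norm = δ} =
      #{p : F × F | p.1 ^ 2 + b * p.2 * p.1 + -(a * p.2 ^ 2 + δ) = 0} := by
    rw [← Fintype.card_subtype, ← Nat.card_eq_fintype_card]
    refine Nat.card_congr ((QuadraticAlgebra.equivProd a b).subtypeEquiv fun k ↦ ?_)
    rw [QuadraticAlgebra.norm_def, ← sub_eq_zero]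
    exact iff_of_eq (congr_arg (· = 0) (by dsimp [QuadraticAlgebra.equivProd]; ring))
  rw [hcard, Nat.card_eq_fintype_card]
  exact card_filter_monic_quadratic_le (b * ·) fun y ↦ -(a * y ^ 2 + δ)

end NormEquation

section Companion

open Matrix

/-- The companion matrix of `X ^ 2 - t * X + n`, with its columns listing the images of `1` and `X`
under multiplication by `X` on `R[X] / (X ^ 2 - t * X + n)`. Over a field it is the normal form of
the nonscalar `2 × 2` matrices of trace `t` and determinant `n`. -/
def companion {R : Type*} [CommRing R] (t n : R) : Matrix (Fin 2) (Fin 2) R := !![0, -n; 1, t]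

theorem exists_eq_units_conj_companion {F : Type*} [Field F] {A : Matrix (Fin 2) (Fin 2) F}
    (hA : A ∉ Set.range (scalar (Fin 2))) :
    ∃ P : GL (Fin 2) F, A = P * companion A.trace A.det * (P⁻¹ : GL (Fin 2) F) := by
  obtain ⟨v, hv⟩ : ∃ v : Fin 2 → F, v 0 * (A *ᵥ v) 1 - v 1 * (A *ᵥ v) 0 ≠ 0 := by
    by_contra! h
    simp only [mulVec, dotProduct, Fin.sum_univ_two] at h
    have h10 : A 1 0 = 0 := by simpa using h ![1, 0]
    have h01 : A 0 1 = 0 := by simpa using h ![0, 1]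
    have h11 : A 1 1 - A 0 0 = 0 := by simpa [h10, h01] using h ![1, 1]
    refine hA ⟨A 0 0, ?_⟩
    ext i j
    fin_cases i <;> fin_cases j <;> simp [h10, h01, sub_eq_zero.1 h11]
  have hdet : det !![v 0, (A *ᵥ v) 0; v 1, (A *ᵥ v) 1] ≠ 0 := by
    rwa [det_fin_two_of, mul_comm ((A *ᵥ v) 0)]
  let P := GeneralLinearGroup.mkOfDetNeZero _ hdet
  have hAP : A * P = P * companion A.trace A.det := by
    simp only [P, GeneralLinearGroup.val_mkOfDetNeZero, companion, trace_fin_two, det_fin_two,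
      mulVec, dotProduct, Fin.sum_univ_two]
    ext i j
    fin_cases i <;> fin_cases j <;> simp [mul_apply, Fin.sum_univ_two] <;> ring
  exact ⟨P, by rw [← hAP, mul_assoc, Units.mul_inv, mul_one]⟩

section Intertwiners

variable {R : Type*} [CommRing R]

theorem semiconjBy_companion_iff {t n : R} {Y : Matrix (Fin 2) (Fin 2) R} :
    SemiconjBy Y (companion t n) (companion t n) ↔
      Y = !![Y 0 0, -n * Y 1 0; Y 1 0, Y 0 0 + t * Y 1 0] := by
  constructor
  · intro h
    have h01 : Y 0 1 = -n * Y 1 0 := by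
      simpa [companion, mul_apply, Fin.sum_univ_two] using congr_fun₂ h.eq 0 0
    have h11 : Y 1 1 = Y 0 0 + t * Y 1 0 := by
      simpa [companion, mul_apply, Fin.sum_univ_two] using congr_fun₂ h.eq 1 0
    rw [← h01, ← h11]
    exact eta_fin_two Y
  · intro h
    rw [h, SemiconjBy, companion]
    ext i j
    fin_cases i <;> fin_cases j <;> simp [mul_apply, Fin.sum_univ_two] <;> ring

theorem card_centralizer_companion_det_eq (t n d : R) :
    Nat.card {Y : Matrix (Fin 2) (Fin 2) R //
      SemiconjBy Y (companion t n) (companion t n) ∧ det Y = d} =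
    Nat.card {k : QuadraticAlgebra R (-n) t // k.norm = d} := by
  have det_eq (x y : R) :
      det !![x, -n * y; y, x + t * y] = (⟨x, y⟩ : QuadraticAlgebra R (-n) t).norm := by
    rw [det_fin_two_of, QuadraticAlgebra.norm_def]
    ring
  exact Nat.card_congr
    { toFun Y := ⟨⟨Y.1 0 0, Y.1 1 0⟩, by
        rw [← det_eq, ← semiconjBy_companion_iff.1 Y.2.1, Y.2.2]⟩
      invFun k := ⟨!![k.1.re, -n * k.1.im; k.1.im, k.1.re + t * k.1.im],
        semiconjBy_companion_iff.2 (by simp), (det_eq _ _).trans k.2⟩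
      left_inv Y := Subtype.ext (semiconjBy_companion_iff.1 Y.2.1).symm
      right_inv k := by simp }

theorem card_semiconjBy_units_conj_det_eq {m : Type*} [Fintype m] [DecidableEq m] (P Q : GL m R)
    (A B : Matrix m m R) (d : R) :
    Nat.card {Y : Matrix m m R // SemiconjBy Y (P * A * (P⁻¹ : GL m R)) (Q * B * (Q⁻¹ : GL m R)) ∧
      det Y = d} =
    Nat.card {Y : Matrix m m R // SemiconjBy Y A B ∧
      det Y = (GeneralLinearGroup.det (Q⁻¹ * P) : Rˣ) * d} := by
  refine Nat.card_congr (((Units.mulLeft Q⁻¹).trans (Units.mulRight P)).subtypeEquiv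
    fun Y ↦ and_congr ?_ ?_)
  · simp only [SemiconjBy, Equiv.trans_apply, Units.mulLeft_apply, Units.mulRight_apply, mul_assoc,
      Units.inv_mul_eq_iff_eq_mul]
    rw [← mul_assoc, ← mul_assoc, Units.mul_inv_eq_iff_eq_mul]
    simp only [mul_assoc]
  · have det_conj : det ((Q⁻¹ : GL m R).1 * Y * P.1) =
        (GeneralLinearGroup.det (Q⁻¹ * P) : Rˣ) * det Y := by
      rw [det_mul, det_mul, map_mul, Units.val_mul, mul_right_comm]
      rfl
    exact (Units.mul_right_inj _).symm.trans (by rw [← det_conj]; rfl)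

end Intertwiners

theorem exists_card_semiconjBy_det_eq {F : Type*} [Field F] {A B : Matrix (Fin 2) (Fin 2) F}
    (hA : A ∉ Set.range (scalar (Fin 2))) (hB : B ∉ Set.range (scalar (Fin 2)))
    (htr : A.trace = B.trace) (hdet : A.det = B.det) :
    ∃ u : Fˣ, ∀ d, Nat.card {Y : Matrix (Fin 2) (Fin 2) F // SemiconjBy Y A B ∧ det Y = d} =
      Nat.card {k : QuadraticAlgebra F (-A.det) A.trace // k.norm = u * d} := by
  obtain ⟨P, hP⟩ := exists_eq_units_conj_companion hA
  obtain ⟨Q, hQ⟩ := exists_eq_units_conj_companion hB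
  rw [← htr, ← hdet] at hQ
  refine ⟨GeneralLinearGroup.det (Q⁻¹ * P), fun d ↦ ?_⟩
  rw [← card_centralizer_companion_det_eq, ← card_semiconjBy_units_conj_det_eq, ← hP, ← hQ]

end Companion

theorem normalizedFiberCard_mulEquiv {G H : Type*} [Group G] [Group H] [Finite G] [Finite H]
    (e : G ≃* H) (g : G) : normalizedFiberCard (e g) = normalizedFiberCard g := by
  have h : Nat.card (commutatorFiber g) = Nat.card (commutatorFiber (e g)) := by
    refine Nat.card_congr ((e.toEquiv.prodCongr e.toEquiv).subtypeEquiv fun p ↦ ?_)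
    simp only [commutatorFiber, Set.mem_ofPred_eq, Equiv.prodCongr_apply, Prod.map_fst,
      Prod.map_snd, MulEquiv.toEquiv_eq_coe, MulEquiv.coe_toEquiv, ← map_inv, ← map_mul]
    exact e.injective.eq_iff.symm
  rw [normalizedFiberCard, normalizedFiberCard, h, Nat.card_congr e.toEquiv]

theorem card_commutatorFiber {G : Type*} [Group G] [Fintype G] (g : G) :
    Nat.card (commutatorFiber g) = ∑ z : G, Nat.card {y : G // SemiconjBy y z (z * g)} := by
  rw [← Nat.card_sigma]
  refine Nat.card_congr (.trans (.subtypeEquiv ((Equiv.inv G).prodCongr (.refl G)) fun p ↦ ?_)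
    (Equiv.subtypeProdEquivSigmaSubtype fun z y : G ↦ SemiconjBy y z (z * g)))
  simp only [commutatorFiber, Set.mem_ofPred_eq, Equiv.prodCongr_apply, Prod.map_fst,
    Prod.map_snd, Equiv.inv_apply, Equiv.refl_apply, SemiconjBy]
  rw [mul_assoc p.1⁻¹, eq_inv_mul_iff_mul_eq, mul_inv_eq_iff_eq_mul, mul_assoc p.1]

section SpecialLinear

open Matrix

section CommRing

variable {R : Type*} [CommRing R]

/-- Conjugation by an invertible matrix, as an automorphism of the special linear group. It
brings the noncentral elements of `SL(2, F)` to companion form, which conjugation inside `SL(2, F)`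
does not always do. -/
def conjSL {n : Type*} [Fintype n] [DecidableEq n] (P : GL n R) :
    Matrix.SpecialLinearGroup n R ≃* Matrix.SpecialLinearGroup n R where
  toFun z := ⟨P * z * (P⁻¹ : GL n R), by rw [det_units_conj, z.2]⟩
  invFun z := ⟨(P⁻¹ : GL n R) * z * P, by rw [det_units_conj', z.2]⟩
  left_inv z := by
    ext1
    simp [mul_assoc]
  right_inv z := by
    ext1
    simp [mul_assoc]
  map_mul' z w := Subtype.ext <| congr_arg Units.val <|
    map_mul (MulAut.conj P) (Matrix.SpecialLinearGroup.toGL z) (Matrix.SpecialLinearGroup.toGL w)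

/-- The companion matrix of `X ^ 2 - t * X + 1`, as an element of `SL(2, R)`: the representative of
the `GL(2, F)`-orbit of noncentral elements of trace `t` when `R = F` is a field. -/
def companionSL (t : R) : SL(2, R) := ⟨companion t 1, by simp [companion, det_fin_two]⟩

theorem SL_trace_eq_of_isConj {n : Type*} [Fintype n] [DecidableEq n]
    {z w : Matrix.SpecialLinearGroup n R} (h : IsConj z w) : z.1.trace = w.1.trace := by
  obtain ⟨y, rfl⟩ := isConj_iff.1 h
  rw [Matrix.SpecialLinearGroup.coe_mul, trace_mul_comm, ← Matrix.SpecialLinearGroup.coe_mul,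
    inv_mul_cancel_left]

end CommRing

section Field

variable {F : Type*} [Field F]

theorem SL2_mem_center_iff {z : SL(2, F)} : z ∈ Subgroup.center SL(2, F) ↔ z = 1 ∨ z = -1 := by
  constructor
  · intro hz
    obtain ⟨r, hr, hrz⟩ := Matrix.SpecialLinearGroup.mem_center_iff.1 hz
    rw [Fintype.card_fin, sq_eq_one_iff] at hr
    refine hr.imp ?_ ?_ <;> rintro rfl <;> refine Subtype.ext (hrz.symm.trans ?_)
    · exact map_one _
    · exact (map_neg _ _).trans (congr_arg _ (map_one _))
  · rintro (rfl | rfl)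
    · exact one_mem _
    · exact Subgroup.mem_center_iff.2 fun w ↦ by rw [mul_neg_one, neg_one_mul]

theorem SL2_trace_sq_of_mem_center {z : SL(2, F)} (hz : z ∈ Subgroup.center SL(2, F)) :
    z.1.trace ^ 2 = 4 := by
  rcases SL2_mem_center_iff.1 hz with rfl | rfl <;> norm_num [trace_fin_two]

theorem SL2_notMem_range_scalar {z : SL(2, F)} (hz : z ∉ Subgroup.center SL(2, F)) :
    z.1 ∉ Set.range (scalar (Fin 2)) := by
  rintro ⟨r, hr⟩
  refine hz (Matrix.SpecialLinearGroup.mem_center_iff.2 ⟨r, ?_, hr⟩)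
  have := z.2
  rw [← hr] at this
  simpa using this

theorem exists_conjSL_companionSL {g : SL(2, F)} (hg : g ∉ Subgroup.center SL(2, F)) :
    ∃ P, conjSL P (companionSL g.1.trace) = g := by
  obtain ⟨P, hP⟩ := exists_eq_units_conj_companion (SL2_notMem_range_scalar hg)
  rw [g.2] at hP
  exact ⟨P, Subtype.ext hP.symm⟩

theorem exists_card_semiconjBy_eq {z w : SL(2, F)} (hz : z ∉ Subgroup.center SL(2, F))
    (hw : w ∉ Subgroup.center SL(2, F)) (htr : z.1.trace = w.1.trace) :
    ∃ u : Fˣ, Nat.card {y // SemiconjBy y z w} =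
      Nat.card {k : QuadraticAlgebra F (-1) z.1.trace // k.norm = u} := by
  obtain ⟨u, hu⟩ := exists_card_semiconjBy_det_eq (SL2_notMem_range_scalar hz)
    (SL2_notMem_range_scalar hw) htr (z.2.trans w.2.symm)
  specialize hu 1
  rw [z.2, mul_one] at hu
  refine ⟨u, hu ▸ Nat.card_congr
    { toFun y := ⟨y.1, congr_arg Subtype.val y.2.eq, y.1.2⟩
      invFun Y := ⟨⟨Y.1, Y.2.2⟩, Subtype.ext Y.2.1.eq⟩ }⟩

theorem abs_card_semiconjBy_sub_le [Finite F] [DecidableEq F] {z w : SL(2, F)} (hne : z ≠ w)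
    (htr : z.1.trace = w.1.trace) :
    |(Nat.card {y // SemiconjBy y z w} : ℤ) - Nat.card F| ≤
      1 + if z.1.trace ^ 2 = 4 then (Nat.card F : ℤ) else 0 := by
  by_cases hc : z ∈ Subgroup.center SL(2, F) ∨ w ∈ Subgroup.center SL(2, F)
  · have : IsEmpty {y // SemiconjBy y z w} := ⟨fun ⟨y, hy⟩ ↦ hne <| by
      have hconj : IsConj z w := ⟨toUnits y, hy⟩
      exact hc.elim hconj.eq_of_left_mem_center hconj.eq_of_right_mem_center⟩
    have htr_sq : z.1.trace ^ 2 = 4 :=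
      hc.elim SL2_trace_sq_of_mem_center (htr ▸ SL2_trace_sq_of_mem_center)
    rw [Nat.card_of_isEmpty, if_pos htr_sq]
    simp
  · push Not at hc
    obtain ⟨u, hu⟩ := exists_card_semiconjBy_eq hc.1 hc.2 htr
    rw [hu]
    split_ifs with h
    · have := card_norm_eq_le_two_mul (-1) z.1.trace (u : F)
      rw [abs_le]
      constructor <;> omega
    · rw [add_zero]
      exact abs_card_norm_eq_sub_le_one (fun h0 ↦ h (by linear_combination h0)) u.ne_zero

end Field

theorem card_SL_mul_card_units {n R : Type*} [Fintype n] [DecidableEq n] [Nonempty n] [CommRing R] :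
    Nat.card (Matrix.SpecialLinearGroup n R) * Nat.card Rˣ = Nat.card (GL n R) := by
  have hker : Nat.card (GeneralLinearGroup.det (n := n) (R := R)).ker =
      Nat.card (Matrix.SpecialLinearGroup n R) :=
    Nat.card_congr
      { toFun A := ⟨A.1, congr_arg Units.val A.2⟩
        invFun A := ⟨Matrix.SpecialLinearGroup.toGL A, Matrix.SpecialLinearGroup.coeToGL_det A⟩
        left_inv _ := Subtype.ext (Units.ext rfl) }
  rw [← (GeneralLinearGroup.det (n := n) (R := R)).ker.card_mul_index, hker, Subgroup.index_ker,
    MonoidHom.range_eq_top.2 GeneralLinearGroup.det_surjective, Subgroup.card_top]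

theorem card_SL2 {F : Type*} [Field F] [Finite F] :
    Nat.card SL(2, F) = Nat.card F * (Nat.card F ^ 2 - 1) := by
  have := Fintype.ofFinite F
  have h := card_SL_mul_card_units (n := Fin 2) (R := F)
  rw [card_GL_field, Fin.prod_univ_two, Nat.card_units, ← Nat.card_eq_fintype_card, Fin.val_zero,
    Fin.val_one, pow_zero, pow_one, sq, ← Nat.mul_sub_one, ← sq, mul_left_comm, ← mul_assoc] at h
  exact Nat.eq_of_mul_eq_mul_right (Nat.sub_pos_of_lt Finite.one_lt_card) h

end SpecialLinear

section Counting

open Finset Matrix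

section EqualTraces

theorem card_filter_trace_eq_and_trace_mul_companionSL_eq {R : Type*} [CommRing R] [Fintype R]
    [DecidableEq R] (τ t : R) :
    #{z : SL(2, R) | z.1.trace = t ∧ (z * companionSL τ).1.trace = t} =
      #{p : R × R | t * (p.2 - p.1) = p.1 ^ 2 - τ * p.1 * p.2 + p.2 ^ 2 + 1} := by
  have trace_mul (z : SL(2, R)) :
      (z * companionSL τ).1.trace = z 0 1 - z 1 0 + τ * z 1 1 := by
    have hcoe : (z * companionSL τ).1 =
        !![z 0 0, z 0 1; z 1 0, z 1 1] * !![0, -1; 1, τ] := by rw [← eta_fin_two z.1]; rfl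
    rw [hcoe, mul_fin_two, trace_fin_two_of]
    ring
  simp only [trace_mul, trace_fin_two]
  refine card_bij' (fun z _ ↦ (z 1 0, z 1 1))
    (fun p hp ↦ ⟨!![t - p.2, t + p.1 - τ * p.2; p.1, p.2], ?_⟩) ?_ ?_ ?_ ?_
  · rw [det_fin_two_of]
    linear_combination (mem_filter.1 hp).2
  · intro z hz
    obtain ⟨htr, htr_mul⟩ := (mem_filter.1 hz).2
    have hdet : z 0 0 * z 1 1 - z 0 1 * z 1 0 = 1 := (det_fin_two z.1).symm.trans z.2
    refine mem_filter.2 ⟨mem_univ _, ?_⟩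
    linear_combination hdet - z 1 1 * htr + z 1 0 * htr_mul
  · intro p _
    refine mem_filter.2 ⟨mem_univ _, sub_add_cancel _ _, ?_⟩
    change t + p.1 - τ * p.2 - p.1 + τ * p.2 = t
    ring
  · intro z hz
    obtain ⟨htr, htr_mul⟩ := (mem_filter.1 hz).2
    have h00 : t - z 1 1 = z 0 0 := by linear_combination -htr
    have h01 : t + z 1 0 - τ * z 1 1 = z 0 1 := by linear_combination -htr_mul
    ext i j
    fin_cases i <;> fin_cases j <;> simp [h00, h01]
  · intro p _
    simp

variable {F : Type*} [Field F] [Fintype F] [DecidableEq F]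

theorem card_filter_trace_mul_companionSL_mem (τ : F) (S : Finset F) :
    #{z : SL(2, F) | (z * companionSL τ).1.trace = z.1.trace ∧ z.1.trace ∈ S} =
      ∑ t ∈ S, #{p : F × F | t * (p.2 - p.1) = p.1 ^ 2 - τ * p.1 * p.2 + p.2 ^ 2 + 1} := by
  rw [card_eq_sum_card_fiberwise (f := fun z : SL(2, F) ↦ z.1.trace) (t := S)
    fun z hz ↦ (mem_filter.1 hz).2.2]
  refine sum_congr rfl fun t ht ↦ ?_
  rw [← card_filter_trace_eq_and_trace_mul_companionSL_eq, filter_filter]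
  refine congr_arg card (filter_congr fun z _ ↦ ?_)
  constructor
  · rintro ⟨⟨h, -⟩, rfl⟩
    exact ⟨rfl, h⟩
  · rintro ⟨rfl, h⟩
    exact ⟨⟨h, ht⟩, rfl⟩

theorem card_filter_mul_eq (a e : F) :
    #{t : F | t * a = e} = if a = 0 then if e = 0 then Nat.card F else 0 else 1 := by
  split_ifs with ha he
  · simp [ha, he]
  · simp [ha, Ne.symm he]
  · simp only [← eq_div_iff ha, filter_eq', mem_univ, if_true, card_singleton]

theorem card_filter_trace_mul_companionSL (τ : F) :
    (#{z : SL(2, F) | (z * companionSL τ).1.trace = z.1.trace} : ℤ) =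
      Nat.card F ^ 2 - Nat.card F + Nat.card F * #{c : F | (2 - τ) * c ^ 2 + 0 * c + 1 = 0} := by
  have hcount (c d : F) : (#{t : F | t * (d - c) = c ^ 2 - τ * c * d + d ^ 2 + 1} : ℤ) =
      1 + if d = c then
        (if (2 - τ) * c ^ 2 + 0 * c + 1 = 0 then (Nat.card F : ℤ) else 0) - 1 else 0 := by
    rw [card_filter_mul_eq]
    rcases eq_or_ne d c with rfl | h
    · rw [show d ^ 2 - τ * d * d + d ^ 2 + 1 = (2 - τ) * d ^ 2 + 0 * d + 1 by ring]
      simp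
    · simp [h, sub_ne_zero.2 h]
  have hsum : #{z : SL(2, F) | (z * companionSL τ).1.trace = z.1.trace} =
      ∑ c : F, ∑ d : F, #{t : F | t * (d - c) = c ^ 2 - τ * c * d + d ^ 2 + 1} := by
    have h := card_filter_trace_mul_companionSL_mem τ univ
    simp only [mem_univ, and_true] at h
    simp only [h, card_filter]
    rw [sum_comm, Fintype.sum_prod_type]
  rw [hsum]
  push_cast
  simp only [hcount, sum_add_distrib, sum_ite_eq', mem_univ, if_true, sum_sub_distrib, ← sum_filter,
    sum_const, card_univ, nsmul_eq_mul, mul_one, Nat.card_eq_fintype_card]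
  ring

theorem abs_card_filter_trace_mul_companionSL_sub_le (τ : F) :
    |(#{z : SL(2, F) | (z * companionSL τ).1.trace = z.1.trace} : ℤ) - Nat.card F ^ 2| ≤
      Nat.card F := by
  have hk : #{c : F | (2 - τ) * c ^ 2 + 0 * c + 1 = 0} ≤ 2 :=
    card_filter_quadratic_eq_zero_le_two (.inr (.inr one_ne_zero))
  rw [card_filter_trace_mul_companionSL, abs_le]
  constructor <;> nlinarith

theorem card_filter_trace_mul_companionSL_trace_sq_eq_four_le (τ : F) :
    #{z : SL(2, F) | (z * companionSL τ).1.trace = z.1.trace ∧ z.1.trace ^ 2 = 4} ≤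
      4 * Nat.card F := by
  have hconic (t : F) :
      #{p : F × F | t * (p.2 - p.1) = p.1 ^ 2 - τ * p.1 * p.2 + p.2 ^ 2 + 1} ≤
        2 * Nat.card F := by
    rw [Nat.card_eq_fintype_card]
    refine (congr_arg card (filter_congr fun p _ ↦ ?_)).trans_le
      (card_filter_monic_quadratic_le (fun d ↦ t - τ * d) fun d ↦ d ^ 2 - t * d + 1)
    constructor <;> intro h <;> linear_combination -h
  have htraces : #{t : F | t ^ 2 = 4} ≤ 2 := by
    refine (congr_arg card (filter_congr fun t _ ↦ ?_)).trans_le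
      (card_filter_quadratic_eq_zero_le_two (b := 0) (c := -4) (.inl one_ne_zero))
    constructor <;> intro h <;> linear_combination h
  have h := card_filter_trace_mul_companionSL_mem τ {t | t ^ 2 = 4}
  simp only [mem_filter, mem_univ, true_and] at h
  rw [h]
  calc _ ≤ #{t : F | t ^ 2 = 4} • (2 * Nat.card F) := sum_le_card_nsmul _ _ _ fun t _ ↦ hconic t
    _ ≤ 2 * (2 * Nat.card F) := Nat.mul_le_mul_right _ htraces
    _ = 4 * Nat.card F := by ring

end EqualTraces

theorem abs_card_commutatorFiber_companionSL_sub_le {F : Type*} [Field F] [Finite F] (τ : F) :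
    |(Nat.card (commutatorFiber (companionSL τ)) : ℤ) - Nat.card F ^ 3| ≤
      6 * Nat.card F ^ 2 + Nat.card F := by
  classical
  have := Fintype.ofFinite F
  have hne : companionSL τ ≠ 1 := fun h ↦ by
    simpa [companionSL, companion] using congr_arg (fun z : SL(2, F) ↦ z 1 0) h
  set T : Finset SL(2, F) := {z | (z * companionSL τ).1.trace = z.1.trace} with hT
  have hcard : (Nat.card (commutatorFiber (companionSL τ)) : ℤ) =
      ∑ z ∈ T, (Nat.card {y // SemiconjBy y z (z * companionSL τ)} : ℤ) := by
    rw [card_commutatorFiber, Nat.cast_sum]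
    refine (sum_subset (subset_univ _) fun z _ hz ↦ ?_).symm
    have : IsEmpty {y // SemiconjBy y z (z * companionSL τ)} := ⟨fun ⟨y, hy⟩ ↦ hz <|
      mem_filter.2 ⟨mem_univ _, (SL_trace_eq_of_isConj ⟨toUnits y, hy⟩).symm⟩⟩
    simp
  have hT_card : |(#T : ℤ) - Nat.card F ^ 2| ≤ Nat.card F :=
    abs_card_filter_trace_mul_companionSL_sub_le τ
  have hT_parabolic : (#{z ∈ T | z.1.trace ^ 2 = 4} : ℤ) ≤ 4 * Nat.card F := by
    rw [hT, filter_filter]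
    exact_mod_cast card_filter_trace_mul_companionSL_trace_sq_eq_four_le τ
  have hdiff : |∑ z ∈ T, (Nat.card {y // SemiconjBy y z (z * companionSL τ)} : ℤ) -
      #T * Nat.card F| ≤ #T + 4 * Nat.card F * Nat.card F := by
    rw [← nsmul_eq_mul, ← sum_const, ← sum_sub_distrib]
    calc _ ≤ ∑ z ∈ T, |(Nat.card {y // SemiconjBy y z (z * companionSL τ)} : ℤ) - Nat.card F| :=
          abs_sum_le_sum_abs _ _
      _ ≤ ∑ z ∈ T, (1 + if z.1.trace ^ 2 = 4 then (Nat.card F : ℤ) else 0) :=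
          sum_le_sum fun z hz ↦ abs_card_semiconjBy_sub_le
            (fun h ↦ hne (mul_eq_left.1 h.symm)) (mem_filter.1 hz).2.symm
      _ = #T + #{z ∈ T | z.1.trace ^ 2 = 4} * Nat.card F := by
          rw [sum_add_distrib, ← sum_filter, sum_const, sum_const, nsmul_one, nsmul_eq_mul]
      _ ≤ #T + 4 * Nat.card F * Nat.card F := by gcongr
  rw [hcard]
  rw [abs_le] at hT_card hdiff ⊢
  constructor <;> nlinarith

end Counting

theorem abs_div_sub_one_le_of_abs_sub_cube_le {q N : ℝ} (hq : 1 < q)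
    (h : |N - q ^ 3| ≤ 6 * q ^ 2 + q) :
    |N / (q * (q ^ 2 - 1)) - 1| ≤ 6 / (q + 1) + 13 / (q ^ 2 - 1) := by
  have hsq : 0 < q ^ 2 - 1 := by nlinarith
  have hpos : 0 < q * (q ^ 2 - 1) := by positivity
  have hrhs : 6 / (q + 1) + 13 / (q ^ 2 - 1) = (6 * q ^ 2 + 7 * q) / (q * (q ^ 2 - 1)) := by
    have : q - 1 ≠ 0 := by linarith
    rw [show q ^ 2 - 1 = (q + 1) * (q - 1) by ring]
    field_simp
    ring
  rw [hrhs, div_sub_one hpos.ne', abs_div, abs_of_pos hpos]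
  gcongr
  rw [abs_le] at h ⊢
  constructor <;> linarith

theorem abs_normalizedFiberCard_SL2_sub_one_le {F : Type*} [Field F] [Finite F] {g : SL(2, F)}
    (hg : g ∉ Subgroup.center SL(2, F)) :
    |normalizedFiberCard g - 1| ≤
      6 / ((Nat.card F : ℝ) + 1) + 13 / ((Nat.card F : ℝ) ^ 2 - 1) := by
  obtain ⟨P, hP⟩ := exists_conjSL_companionSL hg
  have hq : 1 < Nat.card F := Finite.one_lt_card
  rw [← hP, normalizedFiberCard_mulEquiv, normalizedFiberCard, card_SL2]
  push_cast [Nat.cast_sub (Nat.one_le_pow 2 _ Nat.card_pos)]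
  exact abs_div_sub_one_le_of_abs_sub_cube_le (by exact_mod_cast hq)
    (by exact_mod_cast abs_card_commutatorFiber_companionSL_sub_le g.1.trace)

theorem theorem5p1_general :
    (∃ C : ℝ, ∀ (F : Type*) [Field F] [Finite F], ∀ g : SL(2, F), g ≠ 1 → g ≠ -1 →
      |normalizedFiberCard g - 1| ≤ C * (1 / (Nat.card F : ℝ))) ∧
    (∀ (F : Type*) [Field F] [Finite F], ∀ g : SL(2, F), g ≠ 1 → g ≠ -1 →
      |normalizedFiberCard g - 1| ≤
        6 / ((Nat.card F : ℝ) + 1) + 13 / ((Nat.card F : ℝ) ^ 2 - 1)) := by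
  refine ⟨⟨19, fun F _ _ g h1 h2 ↦ ?_⟩, fun F _ _ g h1 h2 ↦
    abs_normalizedFiberCard_SL2_sub_one_le fun hg ↦ (SL2_mem_center_iff.1 hg).elim h1 h2⟩
  have hq : (2 : ℝ) ≤ Nat.card F := by exact_mod_cast Finite.one_lt_card (α := F)
  calc |normalizedFiberCard g - 1|
      ≤ 6 / ((Nat.card F : ℝ) + 1) + 13 / ((Nat.card F : ℝ) ^ 2 - 1) :=
        abs_normalizedFiberCard_SL2_sub_one_le fun hg ↦ (SL2_mem_center_iff.1 hg).elim h1 h2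
    _ ≤ 6 / Nat.card F + 13 / Nat.card F := by gcongr <;> nlinarith
    _ = 19 * (1 / (Nat.card F : ℝ)) := by ring

theorem theorem5p1 :
    (∃ C : ℝ, ∀ (F : Type*) [Field F] [Finite F], Odd (Nat.card F) →
      ∀ g : SL(2, F), g ≠ 1 → g ≠ -1 →
        |normalizedFiberCard g - 1| ≤ C * (1 / (Nat.card F : ℝ))) ∧
    (∀ (F : Type*) [Field F] [Finite F], Odd (Nat.card F) →
      ∀ g : SL(2, F), g ≠ 1 → g ≠ -1 →
        |normalizedFiberCard g - 1| ≤
          6 / ((Nat.card F : ℝ) + 1) + 13 / ((Nat.card F : ℝ) ^ 2 - 1)) :=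
  theorem5p1_general.imp (.imp fun _ h F _ _ _ ↦ h F) fun h F _ _ _ ↦ h F
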